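/- **Theorem (Non-Asymptotic ADD Bound).** Let $\mathcal Y,\mathcal Z$ be countable alphabets and let $W_{Y,Z|X,\theta}$ be a discrete memoryless channel with input $x\in\{0,1\}$ ($1$ = active probe, $0$ = innocent action), state $\theta\in\{0,1\}$ and outputs in $\mathcal Y\times\mathcal Z$. Put $P^x_\theta(y)=\sum_{z}W(y,z|x,\theta)$ and assume $P^0_1=P^0_0$. Let $$D=\mathbb E_{Y\sim P^1_1}\Big[\ln\tfrac{P^1_1(Y)}{P^1_0(Y)}\Big],\qquad V=\mathbb E_{Y\sim P^1_1}\Big[\Big(\ln\tfrac{P^1_1(Y)}{P^1_0(Y)}\Big)^2\Big],$$ and assume $0<D<\infty$ (in particular $P_1^1\ll P_0^1$) and $V<\infty$. Let $\rho\in\,]0,1[$, $d=|\ln(1-\rho)|$, $C_\rho=\ln((1-\rho)/\rho)$, $\alpha\in\,]0,1/2[$ and $\beta\in\,]0,1]$. The change-point $\Gamma$ has the prior $\mathbb P\{\Gamma=k\}=\rho(1-\rho)^{k-1}$, $k\ge1$; at each time $t=1,2,\dots$ a probing action $X_t\in\{0,1\}$ is drawn by a causal rule, being Bernoulli with a parameter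 $\beta_t(X^{t-1},Y^{t-1})\in[0,1]$ given the past, and $(Y_t,Z_t)$ is the output of the channel at input $X_t$ and state $\theta_t=\mathbb I\{t>\Gamma\}$. Let $\tau$ be the Shiryaev stopping time $$\tau=\inf\{t\ge1:\ p_t\ge 1-\alpha\},\qquad p_t=\mathbb P(\Gamma\le t\mid X_1,Y_1,\dots,X_t,Y_t),\qquad \inf\emptyset=\infty,$$ and suppose that the sensing probability is constant while the rule is running: $\beta_t=\beta$ whenever the rule has not stopped by time $t-1$ (after stopping, $\beta_t$ may be anything, e.g. $0$ or $\beta$). Then the average detection delay $\mathrm{ADD}=\mathbb E[(\tau-\Gamma)^+]$ is finite and satisfies $$\mathrm{ADD}\ \le\ \frac{|\ln\alpha|-|\ln(1-\alpha)|+C_\rho}{\beta D+d}+\frac{\beta V+2d\beta D+d^2}{(\beta D+d)^2}.$$ -/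

import Mathlib

open MeasureTheory ProbabilityTheory
open scoped ENNReal

noncomputable section

namespace CovertQCD

/-- Relative entropy `𝔻(P‖Q) = E_{y ∼ P}[ln (P y / Q y)]` of two PMFs, as a real number
(meaningful when `P ≪ Q` and the series converges absolutely). -/
def relEntropy {A : Type*} (P Q : PMF A) : ℝ :=
  ∑' y, (P y).toReal * Real.log ((P y).toReal / (Q y).toReal)

/-- `𝕍(P‖Q) = E_{y ∼ P}[(ln (P y / Q y))²]` (an uncentred second moment). -/
def relSecondMoment {A : Type*} (P Q : PMF A) : ℝ :=
  ∑' y, (P y).toReal * Real.log ((P y).toReal / (Q y).toReal) ^ 2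

/-- `P ≪ Q` and `𝔻(P‖Q) < ∞`. -/
def FiniteRelEntropy {A : Type*} (P Q : PMF A) : Prop :=
  (∀ y, Q y = 0 → P y = 0) ∧
    Summable fun y => (P y).toReal * Real.log ((P y).toReal / (Q y).toReal)

/-- `𝕍(P‖Q) < ∞`. -/
def FiniteRelSecondMoment {A : Type*} (P Q : PMF A) : Prop :=
  Summable fun y => (P y).toReal * Real.log ((P y).toReal / (Q y).toReal) ^ 2

/-- Alice's observation channel `P^x_θ`, the `𝒴`-marginal of the channel `W(·,· | x, θ)`.
Actions: `true` is an active probe, `false` the innocent action.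
States: `true` is post-change, `false` pre-change. -/
def aliceChannel {𝒴 𝒵 : Type*} (W : Bool → Bool → PMF (𝒴 × 𝒵)) (x θ : Bool) : PMF 𝒴 :=
  (W x θ).map Prod.fst

/-- The geometric prior `π_k = ρ (1 - ρ)^(k-1)` on `{1, 2, …}`. -/
def geomPrior (ρ : ℝ) (k : ℕ) : ℝ :=
  if k = 0 then 0 else ρ * (1 - ρ) ^ (k - 1)

/-- Probability mass of the outcome `x` under the Bernoulli law with success probability `p`. -/
def berMass (p : unitInterval) (x : Bool) : ℝ :=
  if x then (p : ℝ) else 1 - (p : ℝ)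

/-- The first `m` entries of a history of length `n`. -/
def prefixOf {A : Type*} {n : ℕ} (h : Fin n → A) (m : ℕ) (hm : m ≤ n) : Fin m → A :=
  fun i => h (Fin.castLE hm i)

/-- A causal sensing rule: `sense n h` is the probability of probing at time `n + 1` when
the past actions and observations are `h = ((x₁, y₁), …, (xₙ, yₙ))`. -/
abbrev SensingRule (𝒴 : Type*) := (n : ℕ) → (Fin n → Bool × 𝒴) → unitInterval

/-- `(Γ, X, Y, Z)` is a realization, on the probability space `(Ω, μ)`, of the change-point,
probing actions and channel outputs under the sensing rule `sense`: the change-point has the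
geometric prior, `X_t` is Bernoulli with the parameter prescribed by `sense` given the
past, and `(Y_t, Z_t)` is the output of the memoryless channel `W` at input `X_t` and
state `θ_t = 𝟙{t > Γ}`. Times are `t = 1, 2, …`; the values at `t = 0` are not used. -/
structure IsSensingProcess {𝒴 𝒵 Ω : Type*} [MeasurableSpace 𝒴] [MeasurableSpace 𝒵]
    [MeasurableSpace Ω] (W : Bool → Bool → PMF (𝒴 × 𝒵)) (ρ : ℝ) (sense : SensingRule 𝒴)
    (μ : Measure Ω) (Γ : Ω → ℕ) (X : ℕ → Ω → Bool) (Y : ℕ → Ω → 𝒴) (Z : ℕ → Ω → 𝒵) :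
    Prop where
  measurable_changepoint : Measurable Γ
  measurable_action : ∀ t, Measurable (X t)
  measurable_alice : ∀ t, Measurable (Y t)
  measurable_eve : ∀ t, Measurable (Z t)
  law : ∀ (k n : ℕ) (x : Fin n → Bool) (y : Fin n → 𝒴) (z : Fin n → 𝒵),
    μ {ω | Γ ω = k ∧ ∀ i : Fin n,
        X (i + 1) ω = x i ∧ Y (i + 1) ω = y i ∧ Z (i + 1) ω = z i} =
      ENNReal.ofReal (geomPrior ρ k) *
        ∏ i : Fin n,
          (ENNReal.ofReal (berMass (sense i (prefixOf (fun j => (x j, y j)) i i.2.le)) (x i)) *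
            W (x i) (decide (k < (i : ℕ) + 1)) (y i, z i))

/-- The history `((X₁, Y₁), …, (Xₙ, Yₙ))`. -/
def history {𝒴 Ω : Type*} (X : ℕ → Ω → Bool) (Y : ℕ → Ω → 𝒴) (n : ℕ) (ω : Ω) :
    Fin n → Bool × 𝒴 :=
  fun i => (X (i + 1) ω, Y (i + 1) ω)

/-- The posterior probability that the change-point is at most `t`, given that the actions
and observations at the times `1, …, t` are `h`. -/
def posterior {𝒴 Ω : Type*} [MeasurableSpace Ω] (μ : Measure Ω) (Γ : Ω → ℕ)
    (X : ℕ → Ω → Bool) (Y : ℕ → Ω → 𝒴) (t : ℕ) (h : Fin t → Bool × 𝒴) : ℝ :=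
  (ProbabilityTheory.cond μ {ω | history X Y t ω = h}).real {ω | Γ ω ≤ t}

/-- The Shiryaev stopping time: the first `t ≥ 1` at which the posterior probability of
a change is at least `1 - α` (and `⊤` if there is none). -/
def shiryaevTime {𝒴 Ω : Type*} [MeasurableSpace Ω] (α : ℝ) (μ : Measure Ω) (Γ : Ω → ℕ)
    (X : ℕ → Ω → Bool) (Y : ℕ → Ω → 𝒴) (ω : Ω) : ℕ∞ :=
  ⨅ t ∈ {t : ℕ | 1 ≤ t ∧ 1 - α ≤ posterior μ Γ X Y t (history X Y t ω)}, (t : ℕ∞)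

/-- The sensing rule probes with the constant probability `β` as long as the Shiryaev rule
with parameter `α` has not stopped. The behaviour after stopping (innocent or not) is left
unconstrained. -/
def ConstantWhileRunning {𝒴 Ω : Type*} [MeasurableSpace Ω] (α β : ℝ) (sense : SensingRule 𝒴)
    (μ : Measure Ω) (Γ : Ω → ℕ) (X : ℕ → Ω → Bool) (Y : ℕ → Ω → 𝒴) : Prop :=
  ∀ (n : ℕ) (h : Fin n → Bool × 𝒴),
    (∀ (t : ℕ) (ht : t ≤ n), 1 ≤ t → posterior μ Γ X Y t (prefixOf h t ht) < 1 - α) →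
      (sense n h : ℝ) = β

/-- Average detection delay `E[(τ - Γ)⁺]`, as an extended nonnegative number
(subtraction in `ℕ∞` is truncated at zero). -/
def averageDetectionDelay {Ω : Type*} [MeasurableSpace Ω] (μ : Measure Ω) (Γ : Ω → ℕ)
    (τ : Ω → ℕ∞) : ℝ≥0∞ :=
  ∫⁻ ω, ((τ ω - (Γ ω : ℕ∞) : ℕ∞) : ℝ≥0∞) ∂μ

end CovertQCD

end

/-! Fix the event `Γ = k`. Bounding the posterior odds of a change from below by the contribution of
`Γ = k` alone gives the factor ρ/(1-ρ) times exp(S), where S adds, at each time after k, the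
log-likelihood ratio plus d = -ln(1-ρ); d is the geometric tail lost per step. So while the Shiryaev
rule runs, S stays below A = ln((1-α)/α) + ln((1-ρ)/ρ) (`IsSensingProcess.driftedWalk_lt`). As long
as it runs the probing probability is β, so the increments of S behave as i.i.d. draws from
`stepLaw`, and the delay is dominated by the time a random walk needs to reach A.

That time is bounded by Lorden's inequality, A/m + v/m² with m, v the first two moments of a step
(`passageMean_le_of_pos`). Here m = βD + d and v = βV + 2dβD + d², because a passive step
contributes exactly d.

No i.i.d. walk is built on Ω: `passageMean` is defined by the first-step recursion, and
`IsSensingProcess.sum_measure_isRunning_le` compares tail probabilities with it by induction on a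
finite horizon. The bounds are uniform in the horizon, which then tends to infinity. -/

namespace CovertQCD

/-! ### Lorden's inequality for truncated passage times. -/

/-- Mean of the passage time above the level `b`, truncated at `n` steps, of a random walk with
steps distributed as `ξ` under `ν`; the passage time is zero for nonpositive levels. -/
noncomputable def passageMean {B : Type*} [MeasurableSpace B] (ν : Measure B) (ξ : B → ℝ) :
    ℕ → ℝ → ℝ
  | 0, _ => 0
  | n + 1, b => if 0 < b then 1 + ∫ a, passageMean ν ξ n (b - ξ a) ∂ν else 0

section Lorden

variable {B : Type*} [MeasurableSpace B] {ν : Measure B} {ξ : B → ℝ}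

lemma passageMean_of_nonpos (n : ℕ) {b : ℝ} (hb : b ≤ 0) : passageMean ν ξ n b = 0 := by
  cases n with
  | zero => rfl
  | succ n => simp [passageMean, not_lt.2 hb]

lemma passageMean_succ_of_pos (n : ℕ) {b : ℝ} (hb : 0 < b) :
    passageMean ν ξ (n + 1) b = 1 + ∫ a, passageMean ν ξ n (b - ξ a) ∂ν := by
  simp [passageMean, hb]

lemma passageMean_nonneg (n : ℕ) (b : ℝ) : 0 ≤ passageMean ν ξ n b := by
  induction n generalizing b with
  | zero => exact le_rfl
  | succ n ih =>
    rcases lt_or_ge 0 b with hb | hb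
    · rw [passageMean_succ_of_pos n hb]
      have := integral_nonneg (μ := ν) (f := fun a => passageMean ν ξ n (b - ξ a))
        fun a => ih _
      linarith
    · rw [passageMean_of_nonpos _ hb]

lemma integral_passageMean_nonneg (n : ℕ) (b : ℝ) :
    0 ≤ ∫ s in 0..b, passageMean ν ξ n s := by
  rcases le_total 0 b with hb | hb
  · exact intervalIntegral.integral_nonneg hb fun s _ => passageMean_nonneg _ _
  · rw [intervalIntegral.integral_symm, intervalIntegral.integral_congr (g := fun _ => (0 : ℝ))]
    · simp
    · intro s hs
      rw [Set.uIcc_of_le hb] at hs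
      exact passageMean_of_nonpos n hs.2

lemma integral_passageMean_of_nonpos (n : ℕ) {b : ℝ} (hb : b ≤ 0) :
    ∫ s in 0..b, passageMean ν ξ n s = 0 := by
  rw [intervalIntegral.integral_congr (g := fun _ => (0 : ℝ))]
  · simp
  · intro s hs
    rw [Set.uIcc_of_ge hb] at hs
    exact passageMean_of_nonpos n hs.2

variable [IsProbabilityMeasure ν]

lemma integrable_passageMean_aux (hξ : Measurable ξ) {n : ℕ}
    (hm : Monotone (passageMean ν ξ n)) (hle : ∀ b, passageMean ν ξ n b ≤ n) (b : ℝ) :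
    Integrable (fun a => passageMean ν ξ n (b - ξ a)) ν := by
  refine Integrable.of_bound (hm.measurable.comp (by fun_prop)).aestronglyMeasurable n ?_
  filter_upwards with a
  rw [Real.norm_of_nonneg (passageMean_nonneg _ _)]
  exact hle _

/-- The two claims are proved together because integrability of the shifted function at the next
step needs both: monotonicity for measurability, the bound for domination. -/
lemma monotone_passageMean_and_le (hξ : Measurable ξ) (n : ℕ) :
    Monotone (passageMean ν ξ n) ∧ ∀ b, passageMean ν ξ n b ≤ n := by
  induction n with
  | zero => exact ⟨fun _ _ _ => le_rfl, fun _ => by simp [passageMean]⟩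
  | succ n ih =>
    have hint := integrable_passageMean_aux hξ ih.1 ih.2
    refine ⟨fun b c hbc => ?_, fun b => ?_⟩
    · rcases lt_or_ge 0 b with hb | hb
      · rw [passageMean_succ_of_pos n hb, passageMean_succ_of_pos n (hb.trans_le hbc)]
        gcongr 1 + ?_
        exact integral_mono (hint b) (hint c) fun a => ih.1 (by linarith)
      · rw [passageMean_of_nonpos _ hb]
        exact passageMean_nonneg _ _
    · rcases lt_or_ge 0 b with hb | hb
      · rw [passageMean_succ_of_pos n hb]
        have := integral_mono (hint b) (integrable_const (n : ℝ)) fun a => ih.2 _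
        simp at this
        push_cast
        linarith
      · rw [passageMean_of_nonpos _ hb]
        positivity

lemma monotone_passageMean (hξ : Measurable ξ) (n : ℕ) : Monotone (passageMean ν ξ n) :=
  (monotone_passageMean_and_le hξ n).1

lemma passageMean_le (hξ : Measurable ξ) (n : ℕ) (b : ℝ) : passageMean ν ξ n b ≤ n :=
  (monotone_passageMean_and_le hξ n).2 b

lemma integrable_passageMean (hξ : Measurable ξ) (n : ℕ) (b : ℝ) :
    Integrable (fun a => passageMean ν ξ n (b - ξ a)) ν :=
  integrable_passageMean_aux hξ (monotone_passageMean hξ n) (passageMean_le hξ n) b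

lemma passageMean_le_succ (hξ : Measurable ξ) (n : ℕ) (b : ℝ) :
    passageMean ν ξ n b ≤ passageMean ν ξ (n + 1) b := by
  induction n generalizing b with
  | zero => exact passageMean_nonneg _ _
  | succ n ih =>
    rcases lt_or_ge 0 b with hb | hb
    · rw [passageMean_succ_of_pos _ hb, passageMean_succ_of_pos _ hb]
      gcongr 1 + ?_
      exact integral_mono (integrable_passageMean hξ _ b) (integrable_passageMean hξ _ b)
        fun a => ih _
    · rw [passageMean_of_nonpos _ hb, passageMean_of_nonpos _ hb]

lemma passageMean_mono_time (hξ : Measurable ξ) (b : ℝ) :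
    Monotone fun n => passageMean ν ξ n b :=
  monotone_nat_of_le_succ fun n => passageMean_le_succ hξ n b

/-- Subadditivity: climb a first; the walk is then at or above a, so at most b remains. The second
horizon `N` stays fixed, so that the last term is constant in the induction on `n`. -/
lemma passageMean_add_le (hξ : Measurable ξ) {n N : ℕ} (hn : n ≤ N) (a : ℝ) {b : ℝ}
    (hb : 0 ≤ b) :
    passageMean ν ξ n (a + b) ≤ passageMean ν ξ n a + passageMean ν ξ N b := by
  induction n generalizing a with
  | zero => simpa [passageMean] using passageMean_nonneg N b
  | succ n ih =>
    rcases lt_or_ge 0 a with ha | ha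
    · rw [passageMean_succ_of_pos _ ha, passageMean_succ_of_pos _ (by linarith)]
      have h := integral_mono (μ := ν) (integrable_passageMean hξ n (a + b))
        ((integrable_passageMean hξ n a).add (integrable_const (passageMean ν ξ N b)))
        fun x => by
          have := ih (by lia) (a - ξ x)
          rwa [sub_add_eq_add_sub] at this
      simp only [Pi.add_apply] at h
      rw [integral_add (integrable_passageMean hξ n a) (integrable_const _)] at h
      simp at h
      linarith
    · rw [passageMean_of_nonpos _ ha, zero_add]
      exact (monotone_passageMean hξ _ (by linarith)).trans (passageMean_mono_time hξ b hn)

lemma intervalIntegrable_passageMean (hξ : Measurable ξ) (n : ℕ) (a b : ℝ) :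
    IntervalIntegrable (passageMean ν ξ n) volume a b :=
  (monotone_passageMean hξ n).intervalIntegrable

/-- Integrate the subadditivity bound for b = s + (b - s) over s in [0, b]. -/
lemma mul_passageMean_le_integral (hξ : Measurable ξ) (n : ℕ) {b : ℝ} (hb : 0 ≤ b) :
    b * passageMean ν ξ n b ≤ 2 * ∫ s in 0..b, passageMean ν ξ n s := by
  have hi := intervalIntegrable_passageMean (ν := ν) hξ n 0 b
  have hi' : IntervalIntegrable (fun s => passageMean ν ξ n (b - s)) volume 0 b := by
    simpa using (intervalIntegrable_passageMean (ν := ν) hξ n b 0).comp_sub_left b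
  have h := intervalIntegral.integral_mono_on (μ := volume)
    (f := fun _ => passageMean ν ξ n b)
    (g := fun s => passageMean ν ξ n s + passageMean ν ξ n (b - s)) hb
    (by simp) (hi.add hi') fun s hs => by
      have := passageMean_add_le (ν := ν) hξ le_rfl s (sub_nonneg.2 hs.2) (n := n)
      simpa using this
  rw [intervalIntegral.integral_add hi hi', intervalIntegral.integral_comp_sub_left
    (fun s => passageMean ν ξ n s)] at h
  simp at h
  linarith

lemma abs_integral_passageMean_le (hξ : Measurable ξ) (n : ℕ) (b c : ℝ) :
    |∫ s in b..c, passageMean ν ξ n s| ≤ n * |c - b| := by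
  refine intervalIntegral.norm_integral_le_of_norm_le_const (f := passageMean ν ξ n)
    fun s _ => ?_
  rw [Real.norm_of_nonneg (passageMean_nonneg _ _)]
  exact passageMean_le hξ n s

lemma integrable_integral_passageMean (hξ : Measurable ξ) (hint : Integrable ξ ν) (n : ℕ)
    (b : ℝ) : Integrable (fun a => ∫ s in 0..(b - ξ a), passageMean ν ξ n s) ν := by
  have hc : Continuous fun t => ∫ s in 0..t, passageMean ν ξ n s :=
    intervalIntegral.continuous_primitive (intervalIntegrable_passageMean hξ n) 0
  refine Integrable.mono' (g := fun a => n * |b - ξ a|)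
    (((integrable_const b).sub hint).abs.const_mul _)
    (hc.measurable.comp (by fun_prop)).aestronglyMeasurable ?_
  filter_upwards with a
  simpa using abs_integral_passageMean_le (ν := ν) hξ n 0 (b - ξ a)

/-- Integrate the first-step recursion over the level and swap integrals. The shift leaves the
integral from 0 to -ξ, which is nonnegative and is discarded. -/
lemma integral_passageMean_succ_le (hξ : Measurable ξ) (hint : Integrable ξ ν) (n : ℕ) {b : ℝ}
    (hb : 0 < b) :
    ∫ s in 0..b, passageMean ν ξ (n + 1) s ≤
      b + ∫ a, (∫ s in 0..(b - ξ a), passageMean ν ξ n s) ∂ν := by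
  have : IsFiniteMeasure (volume.restrict (Set.uIoc 0 b)) :=
    ⟨by simp [Set.uIoc_of_le hb.le]⟩
  have hprod : Integrable (Function.uncurry fun s a => passageMean ν ξ n (s - ξ a))
      ((volume.restrict (Set.uIoc 0 b)).prod ν) := by
    refine Integrable.of_bound (C := n) ((monotone_passageMean hξ n).measurable.comp
      (by fun_prop : Measurable fun p : ℝ × B => p.1 - ξ p.2)).aestronglyMeasurable ?_
    filter_upwards with p
    rw [Function.uncurry, Real.norm_of_nonneg (passageMean_nonneg _ _)]
    exact passageMean_le hξ n _
  have h1 : ∫ s in 0..b, passageMean ν ξ (n + 1) s =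
      ∫ s in 0..b, (1 + ∫ a, passageMean ν ξ n (s - ξ a) ∂ν) := by
    refine intervalIntegral.integral_congr_ae ?_
    filter_upwards with s hs
    rw [Set.uIoc_of_le hb.le] at hs
    exact passageMean_succ_of_pos n hs.1
  have h2 : IntervalIntegrable (fun s => ∫ a, passageMean ν ξ n (s - ξ a) ∂ν) volume 0 b := by
    rw [intervalIntegrable_iff]
    exact hprod.integral_prod_left
  rw [h1, intervalIntegral.integral_add (by simp) h2,
    intervalIntegral_integral_swap hprod]
  simp only [intervalIntegral.integral_const, sub_zero, smul_eq_mul, mul_one]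
  gcongr b + ?_
  have h3 : ∀ a, ∫ s in 0..b, passageMean ν ξ n (s - ξ a) =
      (∫ s in 0..(b - ξ a), passageMean ν ξ n s) - ∫ s in 0..(0 - ξ a), passageMean ν ξ n s := by
    intro a
    rw [intervalIntegral.integral_comp_sub_right (fun s => passageMean ν ξ n s),
      intervalIntegral.integral_interval_sub_left] <;>
    exact intervalIntegrable_passageMean hξ n _ _
  have hb' := integrable_integral_passageMean (ν := ν) hξ hint n b
  have h0' := integrable_integral_passageMean (ν := ν) hξ hint n 0
  simp_rw [h3]
  rw [integral_sub hb' h0']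
  have := integral_nonneg (μ := ν) (f := fun a => ∫ s in 0..(0 - ξ a), passageMean ν ξ n s)
    fun a => integral_passageMean_nonneg n _
  linarith

/-- Upper counterpart of `mul_passageMean_le_integral`: together they give a quadratic inequality
for the passage mean, which is Lorden's bound. The form is chosen to reproduce itself under the
first-step recursion. -/
lemma two_mul_integral_passageMean_le (hξ : Measurable ξ) (hint : Integrable ξ ν)
    (hsq : Integrable (fun a => ξ a ^ 2) ν) (hm : 0 ≤ ∫ a, ξ a ∂ν) (n : ℕ) (b : ℝ) :
    2 * (∫ a, ξ a ∂ν) * ∫ s in 0..b, passageMean ν ξ n s ≤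
      (∫ a, ξ a ^ 2 ∂ν) * passageMean ν ξ n b - (∫ a, ξ a ∂ν) ^ 2 * passageMean ν ξ n b ^ 2 +
        2 * (∫ a, ξ a ∂ν) * b * passageMean ν ξ n b := by
  set m := ∫ a, ξ a ∂ν
  set v := ∫ a, ξ a ^ 2 ∂ν
  induction n generalizing b with
  | zero => simp [passageMean]
  | succ n ih =>
    rcases le_or_gt b 0 with hb | hb
    · simp [integral_passageMean_of_nonpos _ hb, passageMean_of_nonpos _ hb]
    set w := fun a => passageMean ν ξ n (b - ξ a) with hw
    have hwm : AEStronglyMeasurable w ν :=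
      ((monotone_passageMean hξ n).measurable.comp (by fun_prop)).aestronglyMeasurable
    have hwb : ∀ᵐ a ∂ν, ‖w a‖ ≤ n := by
      filter_upwards with a
      rw [Real.norm_of_nonneg (passageMean_nonneg _ _)]
      exact passageMean_le hξ n _
    have hwi : Integrable w ν := integrable_passageMean hξ n b
    have hww : Integrable (fun a => w a ^ 2) ν := by
      simpa only [pow_two] using hwi.bdd_mul hwm hwb
    have hxw : Integrable (fun a => ξ a * w a) ν := by
      simpa only [mul_comm] using hint.bdd_mul hwm hwb
    have hU := integral_passageMean_succ_le (ν := ν) hξ hint n hb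
    have hI := integral_mono (μ := ν)
      (f := fun a => 2 * m * ∫ s in 0..(b - ξ a), passageMean ν ξ n s)
      (g := fun a => (v + 2 * m * b) * w a - m ^ 2 * w a ^ 2 - 2 * m * (ξ a * w a))
      ((integrable_integral_passageMean hξ hint n b).const_mul _)
      (((hwi.const_mul _).sub (hww.const_mul _)).sub (hxw.const_mul _))
      fun a => by
        have := ih (b - ξ a)
        simp only [hw]
        linarith
    rw [integral_const_mul, integral_sub (by fun_prop) (by fun_prop),
      integral_sub (by fun_prop) (by fun_prop), integral_const_mul, integral_const_mul,
      integral_const_mul] at hI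
    have hsum : Integrable (fun a => ξ a + m * w a) ν := hint.add (hwi.const_mul m)
    have hsum2 : ∫ a, (ξ a + m * w a) ∂ν = m * (1 + ∫ a, w a ∂ν) := by
      rw [integral_add hint (hwi.const_mul m), integral_const_mul]
      ring
    -- Jensen for ξ + m w, whose mean is m times the new passage mean; this creates the negative
    -- square in the claim.
    have hJ : (∫ a, (ξ a + m * w a) ∂ν) ^ 2 ≤
        v + 2 * m * ∫ a, ξ a * w a ∂ν + m ^ 2 * ∫ a, w a ^ 2 ∂ν := by
      set c := ∫ a, (ξ a + m * w a) ∂ν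
      have hpos := integral_nonneg (μ := ν) (f := fun a => (ξ a + m * w a - c) ^ 2)
        fun a => sq_nonneg _
      have he : ∀ a, (ξ a + m * w a - c) ^ 2 =
          (ξ a ^ 2 + 2 * m * (ξ a * w a)) + m ^ 2 * w a ^ 2 + (-2 * c * (ξ a + m * w a) + c ^ 2) :=
        fun a => by ring
      simp_rw [he] at hpos
      rw [integral_add (by fun_prop) (by fun_prop), integral_add (by fun_prop) (by fun_prop),
        integral_add (by fun_prop) (by fun_prop), integral_add (by fun_prop) (by fun_prop),
        integral_const_mul, integral_const_mul, integral_const_mul] at hpos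
      simp only [integral_const, probReal_univ, one_smul] at hpos
      change 0 ≤ v + _ + _ + (-2 * c * c + c ^ 2) at hpos
      linarith
    rw [hsum2] at hJ
    rw [passageMean_succ_of_pos n hb]
    change _ ≤ v * (1 + ∫ a, w a ∂ν) - m ^ 2 * (1 + ∫ a, w a ∂ν) ^ 2 +
      2 * m * b * (1 + ∫ a, w a ∂ν)
    have := mul_le_mul_of_nonneg_left hU (by linarith : 0 ≤ 2 * m)
    linarith

/-- Lorden's inequality for the mean passage time of a random walk with positive drift. -/
theorem passageMean_le_of_pos (hξ : Measurable ξ) (hint : Integrable ξ ν)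
    (hsq : Integrable (fun a => ξ a ^ 2) ν) (hm : 0 < ∫ a, ξ a ∂ν) (n : ℕ) {b : ℝ}
    (hb : 0 ≤ b) :
    passageMean ν ξ n b ≤ b / (∫ a, ξ a ∂ν) + (∫ a, ξ a ^ 2 ∂ν) / (∫ a, ξ a ∂ν) ^ 2 := by
  have h1 := two_mul_integral_passageMean_le hξ hint hsq hm.le n b
  have h2 := mul_passageMean_le_integral (ν := ν) hξ n hb
  have hv : 0 ≤ ∫ a, ξ a ^ 2 ∂ν := integral_nonneg fun a => sq_nonneg _
  set m := ∫ a, ξ a ∂ν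
  set v := ∫ a, ξ a ^ 2 ∂ν
  set u := passageMean ν ξ n b
  have hu : 0 ≤ u := passageMean_nonneg _ _
  have h3 : u * (m ^ 2 * u) ≤ u * (m * b + v) := by
    have := mul_le_mul_of_nonneg_left h2 hm.le
    linarith
  have he : b / m + v / m ^ 2 = (m * b + v) / m ^ 2 := by field_simp
  rw [he, le_div_iff₀ (by positivity)]
  -- The quadratic inequality `h3` can be divided by u only when u > 0.
  rcases hu.eq_or_lt with h | h
  · rw [← h]
    have : 0 ≤ m * b := by positivity
    linarith
  · linarith [le_of_mul_le_mul_left h3 h]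

end Lorden

end CovertQCD

/-! ### Likelihoods of histories and the drifted walk. -/

namespace CovertQCD

lemma tsum_prod_pi_eq_prod_tsum {A : Type*} {n : ℕ} (f : Fin n → A → ℝ≥0∞) :
    ∑' z : Fin n → A, ∏ i, f i (z i) = ∏ i, ∑' a, f i a := by
  induction n with
  | zero => simp
  | succ n ih =>
    rw [← (Fin.consEquiv fun _ => A).tsum_eq, ENNReal.tsum_prod', Fin.prod_univ_succ, ← ih,
      ← ENNReal.tsum_mul_right]
    refine tsum_congr fun a => ?_
    rw [← ENNReal.tsum_mul_left]
    refine tsum_congr fun z => ?_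
    simp [Fin.consEquiv, Fin.prod_univ_succ]

lemma tsum_fin_succ_eq_tsum_snoc {A : Type*} {n : ℕ} (f : (Fin (n + 1) → A) → ℝ≥0∞) :
    ∑' h, f h = ∑' h : Fin n → A, ∑' a, f (Fin.snoc (α := fun _ => A) h a) := by
  rw [← (Fin.snocEquiv fun _ => A).tsum_eq, ENNReal.tsum_prod', ENNReal.tsum_comm]
  rfl

lemma prod_ite_le_val (k n : ℕ) (r : ℝ) :
    ∏ i : Fin n, (if k ≤ (i : ℕ) then r else 1) = r ^ (n - k) := by
  induction n with
  | zero => simp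
  | succ n ih =>
    rw [Fin.prod_univ_castSucc]
    simp only [Fin.val_castSucc, Fin.val_last, ih]
    split_ifs with h
    · rw [Nat.succ_sub h, pow_succ]
    -- Here n < k, and both truncated differences are 0.
    · rw [show n + 1 - k = n - k by lia, mul_one]

variable {𝒴 𝒵 : Type*}

lemma aliceChannel_apply (W : Bool → Bool → PMF (𝒴 × 𝒵)) (x θ : Bool) (y : 𝒴) :
    aliceChannel W x θ y = ∑' z, W x θ (y, z) := by
  classical
  rw [aliceChannel, PMF.map_apply, ENNReal.tsum_prod', tsum_eq_single y]
  · simp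
  · intro y' hy'
    simp [hy'.symm]

lemma prefixOf_snoc {A : Type*} {n : ℕ} (h : Fin n → A) (a : A) {m : ℕ} (hm : m ≤ n) :
    prefixOf (Fin.snoc (α := fun _ => A) h a) m (hm.trans n.le_succ) = prefixOf h m hm := by
  funext i
  exact Fin.snoc_castSucc (α := fun _ => A) a h (Fin.castLE hm i)

lemma prefixOf_self {A : Type*} {n : ℕ} (h : Fin n → A) : prefixOf h n le_rfl = h := rfl

/-- Probability of the history `h` given that the change-point is `k`. -/
noncomputable def historyMass (W : Bool → Bool → PMF (𝒴 × 𝒵)) (sense : SensingRule 𝒴) (k n : ℕ)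
    (h : Fin n → Bool × 𝒴) : ℝ≥0∞ :=
  ∏ i : Fin n, (ENNReal.ofReal (berMass (sense i (prefixOf h i i.2.le)) (h i).1) *
    aliceChannel W (h i).1 (decide (k < (i : ℕ) + 1)) (h i).2)

lemma historyMass_snoc (W : Bool → Bool → PMF (𝒴 × 𝒵)) (sense : SensingRule 𝒴) (k n : ℕ)
    (h : Fin n → Bool × 𝒴) (b : Bool × 𝒴) :
    historyMass W sense k (n + 1) (Fin.snoc (α := fun _ => Bool × 𝒴) h b) =
      historyMass W sense k n h * (ENNReal.ofReal (berMass (sense n h) b.1) *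
        aliceChannel W b.1 (decide (k < n + 1)) b.2) := by
  rw [historyMass, Fin.prod_univ_castSucc]
  congr 1
  · refine Finset.prod_congr rfl fun i _ => ?_
    simp only [Fin.snoc_castSucc, Fin.val_castSucc]
    rw [prefixOf_snoc h b i.2.le]
  · simp only [Fin.snoc_last, Fin.val_last]
    rw [prefixOf_snoc h b le_rfl, prefixOf_self]

/-- A change after the horizon is invisible, so `historyMass W sense n n` serves as the no-change
likelihood. -/
lemma historyMass_eq_of_le (W : Bool → Bool → PMF (𝒴 × 𝒵)) (sense : SensingRule 𝒴) {k n : ℕ}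
    (hk : n ≤ k) (h : Fin n → Bool × 𝒴) :
    historyMass W sense k n h = historyMass W sense n n h := by
  refine Finset.prod_congr rfl fun i _ => ?_
  have h1 : ¬ k < (i : ℕ) + 1 := by lia
  have h2 : ¬ n < (i : ℕ) + 1 := by lia
  simp [h1, h2]

/-- The post-change drifted log-likelihood ratio of an action and its observation. -/
noncomputable def driftedLLR (W : Bool → Bool → PMF (𝒴 × 𝒵)) (d : ℝ) (b : Bool × 𝒴) : ℝ :=
  Real.log ((aliceChannel W b.1 true b.2).toReal / (aliceChannel W b.1 false b.2).toReal) + d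

/-- The sum of the drifted log-likelihood ratios after the change-point `k`. -/
noncomputable def driftedWalk (W : Bool → Bool → PMF (𝒴 × 𝒵)) (d : ℝ) (k n : ℕ)
    (h : Fin n → Bool × 𝒴) : ℝ :=
  ∑ i : Fin n, if k ≤ (i : ℕ) then driftedLLR W d (h i) else 0

lemma driftedWalk_snoc (W : Bool → Bool → PMF (𝒴 × 𝒵)) (d : ℝ) {k n : ℕ} (hk : k ≤ n)
    (h : Fin n → Bool × 𝒴) (b : Bool × 𝒴) :
    driftedWalk W d k (n + 1) (Fin.snoc (α := fun _ => Bool × 𝒴) h b) =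
      driftedWalk W d k n h + driftedLLR W d b := by
  rw [driftedWalk, Fin.sum_univ_castSucc]
  simp [driftedWalk, hk]

lemma driftedWalk_self (W : Bool → Bool → PMF (𝒴 × 𝒵)) (d : ℝ) (k : ℕ)
    (h : Fin k → Bool × 𝒴) : driftedWalk W d k k h = 0 :=
  Finset.sum_eq_zero fun i _ => if_neg (by lia)

/-- Change of measure. The sensing factors cancel, since the rule sees only the history; each
post-change factor gives a likelihood ratio, with r · exp d = 1 inserted. Nonzero mass and absolute
continuity keep the logarithms genuine. -/
lemma historyMass_toReal_eq (W : Bool → Bool → PMF (𝒴 × 𝒵)) (sense : SensingRule 𝒴)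
    (hac : ∀ x y, aliceChannel W x false y = 0 → aliceChannel W x true y = 0)
    {r d : ℝ} (hrd : r * Real.exp d = 1) {k n : ℕ} {h : Fin n → Bool × 𝒴}
    (hne : historyMass W sense k n h ≠ 0) :
    (historyMass W sense k n h).toReal =
      r ^ (n - k) * (historyMass W sense n n h).toReal * Real.exp (driftedWalk W d k n h) := by
  rw [driftedWalk, Real.exp_sum, ← prod_ite_le_val, historyMass, historyMass, ENNReal.toReal_prod,
    ENNReal.toReal_prod, ← Finset.prod_mul_distrib, ← Finset.prod_mul_distrib]
  refine Finset.prod_congr rfl fun i _ => ?_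
  have hi := Finset.prod_ne_zero_iff.1 hne i (Finset.mem_univ _)
  have hin : ¬ n < (i : ℕ) + 1 := by lia
  rcases le_or_gt k i with hk | hk
  · have hk1 : k < (i : ℕ) + 1 := by lia
    simp only [hk1, hin, hk, decide_true, decide_false, if_true, ENNReal.toReal_mul] at hi ⊢
    have h1 : aliceChannel W (h i).1 true (h i).2 ≠ 0 := right_ne_zero_of_mul hi
    have h0 : aliceChannel W (h i).1 false (h i).2 ≠ 0 := fun h0 => h1 (hac _ _ h0)
    have h1' := ENNReal.toReal_pos h1 (PMF.apply_ne_top _ _)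
    have h0' := ENNReal.toReal_pos h0 (PMF.apply_ne_top _ _)
    rw [driftedLLR, Real.exp_add, Real.exp_log (div_pos h1' h0')]
    set B := (ENNReal.ofReal (berMass (sense i (prefixOf h i i.2.le)) (h i).1)).toReal
    have hq := div_mul_cancel₀ (aliceChannel W (h i).1 true (h i).2).toReal h0'.ne'
    set q := (aliceChannel W (h i).1 true (h i).2).toReal /
      (aliceChannel W (h i).1 false (h i).2).toReal
    linear_combination -B * hq -
      (B * q * (aliceChannel W (h i).1 false (h i).2).toReal) * hrd
  · have hk1 : ¬ k < (i : ℕ) + 1 := by lia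
    simp [hk1, hin, not_le.2 hk]

/-- The law of an action and its observation after the change, when probing with
probability `β`. -/
noncomputable def stepLaw [MeasurableSpace 𝒴] (W : Bool → Bool → PMF (𝒴 × 𝒵)) (β : unitInterval) :
    Measure (Bool × 𝒴) :=
  Measure.sum fun b : Bool × 𝒴 =>
    (ENNReal.ofReal (berMass β b.1) * aliceChannel W b.1 true b.2) • Measure.dirac b

lemma lintegral_stepLaw [MeasurableSpace 𝒴] [MeasurableSingletonClass 𝒴]
    (W : Bool → Bool → PMF (𝒴 × 𝒵)) (β : unitInterval)
    (f : Bool × 𝒴 → ℝ≥0∞) :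
    ∫⁻ b, f b ∂(stepLaw W β) =
      ∑' b, ENNReal.ofReal (berMass β b.1) * aliceChannel W b.1 true b.2 * f b := by
  simp [stepLaw, lintegral_sum_measure, lintegral_smul_measure]

instance isProbabilityMeasure_stepLaw [MeasurableSpace 𝒴] [MeasurableSingletonClass 𝒴]
    (W : Bool → Bool → PMF (𝒴 × 𝒵)) (β : unitInterval) :
    IsProbabilityMeasure (stepLaw W β) := by
  refine ⟨?_⟩
  rw [← lintegral_one, lintegral_stepLaw, ENNReal.tsum_prod']
  have hber : ENNReal.ofReal (1 - β) + ENNReal.ofReal β = 1 := by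
    rw [← ENNReal.ofReal_add (sub_nonneg.2 β.2.2) β.2.1]
    simp
  simpa [ENNReal.tsum_mul_left, tsum_bool, berMass, add_comm] using hber

lemma ofReal_passageMean_succ {B : Type*} [MeasurableSpace B] {ν : Measure B}
    [IsProbabilityMeasure ν] {ξ : B → ℝ} (hξ : Measurable ξ) (n : ℕ) {b : ℝ} (hb : 0 < b) :
    ENNReal.ofReal (passageMean ν ξ (n + 1) b) =
      1 + ∫⁻ a, ENNReal.ofReal (passageMean ν ξ n (b - ξ a)) ∂ν := by
  rw [passageMean_succ_of_pos n hb, ENNReal.ofReal_add zero_le_one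
    (integral_nonneg fun _ => passageMean_nonneg _ _), ENNReal.ofReal_one,
    ofReal_integral_eq_lintegral_ofReal (integrable_passageMean hξ n b)
      (Filter.Eventually.of_forall fun _ => passageMean_nonneg _ _)]

/-! ### The sensing process: posterior odds and comparison with the walk. -/

variable {Ω : Type*} [MeasurableSpace Ω]
  {μ : Measure Ω} {Γ : Ω → ℕ} {X : ℕ → Ω → Bool} {Y : ℕ → Ω → 𝒴} {Z : ℕ → Ω → 𝒵}

/-- The Shiryaev rule with parameter `α` has not stopped along the history `h`. -/
def IsRunning (α : ℝ) (μ : Measure Ω) (Γ : Ω → ℕ) (X : ℕ → Ω → Bool) (Y : ℕ → Ω → 𝒴) (n : ℕ)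
    (h : Fin n → Bool × 𝒴) : Prop :=
  ∀ (t : ℕ) (ht : t ≤ n), 1 ≤ t → posterior μ Γ X Y t (prefixOf h t ht) < 1 - α

lemma IsRunning.of_snoc {α : ℝ} {n : ℕ} {h : Fin n → Bool × 𝒴} {b : Bool × 𝒴}
    (hr : IsRunning α μ Γ X Y (n + 1) (Fin.snoc (α := fun _ => Bool × 𝒴) h b)) :
    IsRunning α μ Γ X Y n h := fun t ht h1 => by
  rw [← prefixOf_snoc h b ht]
  exact hr t _ h1

variable [MeasurableSpace 𝒴] [MeasurableSpace 𝒵]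
  {W : Bool → Bool → PMF (𝒴 × 𝒵)} {ρ : ℝ} {sense : SensingRule 𝒴}

lemma IsSensingProcess.measurable_history (hp : IsSensingProcess W ρ sense μ Γ X Y Z) (n : ℕ) :
    Measurable (history X Y n) :=
  measurable_pi_lambda _ fun _ => (hp.measurable_action _).prodMk (hp.measurable_alice _)

variable [MeasurableSingletonClass 𝒴] [Countable 𝒵] [MeasurableSingletonClass 𝒵]

/-- Sum the law over `Z`; the sum factorizes because the sensing rule does not read `Z`. -/
lemma IsSensingProcess.measure_changepoint_history (hp : IsSensingProcess W ρ sense μ Γ X Y Z)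
    (k n : ℕ) (h : Fin n → Bool × 𝒴) :
    μ {ω | Γ ω = k ∧ history X Y n ω = h} =
      ENNReal.ofReal (geomPrior ρ k) * historyMass W sense k n h := by
  have hset : {ω | Γ ω = k ∧ history X Y n ω = h} = ⋃ z : Fin n → 𝒵,
      {ω | Γ ω = k ∧ ∀ i : Fin n, X (i + 1) ω = (h i).1 ∧ Y (i + 1) ω = (h i).2 ∧
        Z (i + 1) ω = z i} := by
    ext ω
    simp only [Set.mem_ofPred_eq, Set.mem_iUnion, history, funext_iff, Prod.ext_iff]
    constructor
    · rintro ⟨hk, hh⟩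
      exact ⟨fun i => Z (i + 1) ω, hk, fun i => ⟨(hh i).1, (hh i).2, rfl⟩⟩
    · rintro ⟨z, hk, hh⟩
      exact ⟨hk, fun i => ⟨(hh i).1, (hh i).2.1⟩⟩
  rw [hset, measure_iUnion]
  · simp_rw [fun z => hp.law k n (fun i => (h i).1) (fun i => (h i).2) z]
    rw [ENNReal.tsum_mul_left]
    congr 1
    rw [tsum_prod_pi_eq_prod_tsum (fun (i : Fin n) z =>
      ENNReal.ofReal (berMass (sense i (prefixOf (fun j => ((h j).1, (h j).2)) i i.2.le))
        (h i).1) * W (h i).1 (decide (k < (i : ℕ) + 1)) ((h i).2, z))]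
    refine Finset.prod_congr rfl fun i _ => ?_
    rw [ENNReal.tsum_mul_left, aliceChannel_apply]
  · intro z z' hzz'
    refine Set.disjoint_left.2 fun ω h1 h2 => hzz' (funext fun i => ?_)
    exact (h1.2 i).2.2.symm.trans (h2.2 i).2.2
  · intro z
    refine (hp.measurable_changepoint (measurableSet_singleton k)).inter ?_
    have hi := MeasurableSet.iInter fun i : Fin n =>
      (hp.measurable_action (i + 1) (measurableSet_singleton (h i).1)).inter
        ((hp.measurable_alice (i + 1) (measurableSet_singleton (h i).2)).inter
          (hp.measurable_eve (i + 1) (measurableSet_singleton (z i))))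
    refine Eq.mp (congrArg MeasurableSet (Set.ext fun ω => ?_)) hi
    simp only [Set.mem_iInter]
    rfl

lemma tsum_geomPrior_Ioi (hρ : ρ ∈ Set.Ioo (0 : ℝ) 1) (n : ℕ) :
    ∑' k : Set.Ioi n, ENNReal.ofReal (geomPrior ρ k) = ENNReal.ofReal ((1 - ρ) ^ n) := by
  let e : ℕ ≃ Set.Ioi n :=
    { toFun := fun j => ⟨n + 1 + j, by simp; lia⟩
      invFun := fun k => k - (n + 1)
      left_inv := fun j => by simp
      right_inv := fun k => by
        have := k.2
        simp only [Set.mem_Ioi] at this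
        ext
        simp
        lia }
  have hr : 0 < 1 - ρ := sub_pos.2 hρ.2
  have hs := (hasSum_geometric_of_lt_one hr.le (sub_lt_self 1 hρ.1)).mul_left (ρ * (1 - ρ) ^ n)
  have hg : ∀ j, geomPrior ρ (e j) = ρ * (1 - ρ) ^ n * (1 - ρ) ^ j := fun j => by
    have : n + 1 + j - 1 = n + j := by lia
    simp [e, geomPrior, this, pow_add, mul_assoc]
  have hρ0 := hρ.1
  rw [← e.tsum_eq]
  simp_rw [hg]
  rw [← ENNReal.ofReal_tsum_of_nonneg (fun j => by positivity) hs.summable, hs.tsum_eq]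
  congr 1
  rw [sub_sub_cancel]
  field_simp

lemma IsSensingProcess.measure_lt_changepoint_history (hρ : ρ ∈ Set.Ioo (0 : ℝ) 1)
    (hp : IsSensingProcess W ρ sense μ Γ X Y Z) (n : ℕ) (h : Fin n → Bool × 𝒴) :
    μ {ω | n < Γ ω ∧ history X Y n ω = h} =
      ENNReal.ofReal ((1 - ρ) ^ n) * historyMass W sense n n h := by
  have hset : {ω | n < Γ ω ∧ history X Y n ω = h} =
      ⋃ k : Set.Ioi n, {ω | Γ ω = k ∧ history X Y n ω = h} := by
    ext ω
    simp
  rw [hset, measure_iUnion]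
  · simp_rw [hp.measure_changepoint_history]
    rw [← tsum_geomPrior_Ioi hρ, ← ENNReal.tsum_mul_right]
    refine tsum_congr fun k => ?_
    rw [historyMass_eq_of_le W sense (le_of_lt k.2)]
  · intro k k' hkk'
    exact Set.disjoint_left.2 fun ω h1 h2 => hkk' (Subtype.ext (h1.1.symm.trans h2.1))
  · intro k
    exact (hp.measurable_changepoint (measurableSet_singleton _)).inter
      (hp.measurable_history n (measurableSet_singleton h))

variable {α : ℝ} [IsProbabilityMeasure μ]

/-- Posterior below 1 - α means odds below (1-α)/α, and the odds are at least ρ/(1-ρ) times the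
exponential of the walk. -/
lemma IsSensingProcess.driftedWalk_lt (hρ : ρ ∈ Set.Ioo (0 : ℝ) 1)
    (hp : IsSensingProcess W ρ sense μ Γ X Y Z) (hα : α ∈ Set.Ioo (0 : ℝ) 1)
    (hac : ∀ x y, aliceChannel W x false y = 0 → aliceChannel W x true y = 0) {k n : ℕ}
    (hkn : k ≤ n) {h : Fin n → Bool × 𝒴} (hr : IsRunning α μ Γ X Y n h)
    (hne : μ {ω | Γ ω = k ∧ history X Y n ω = h} ≠ 0) :
    driftedWalk W (-Real.log (1 - ρ)) k n h <
      Real.log ((1 - α) / α) + Real.log ((1 - ρ) / ρ) := by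
  obtain ⟨hρ0, hρ1⟩ := hρ
  obtain ⟨hα0, hα1⟩ := hα
  have hJ := hp.measure_changepoint_history k n h
  -- The prior gives no mass to 0; hence n ≥ 1, and running does constrain the posterior at time n.
  have hk : 1 ≤ k := by
    by_contra hk
    obtain rfl : k = 0 := by lia
    simp [hJ, geomPrior] at hne
  have hm : historyMass W sense k n h ≠ 0 := by
    rw [hJ] at hne
    exact right_ne_zero_of_mul hne
  have hmeas : MeasurableSet {ω | history X Y n ω = h} :=
    hp.measurable_history n (measurableSet_singleton h)
  have hpost := hr n le_rfl (hk.trans hkn)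
  rw [prefixOf_self, posterior, Measure.real, cond_apply hmeas, ENNReal.toReal_mul,
    ENNReal.toReal_inv] at hpost
  -- Only the term `Γ = k` of the posterior numerator is kept.
  have hge : μ.real {ω | Γ ω = k ∧ history X Y n ω = h} ≤
      μ.real ({ω | history X Y n ω = h} ∩ {ω | Γ ω ≤ n}) :=
    measureReal_mono fun ω hω => ⟨hω.2, hω.1.le.trans hkn⟩
  have hsplit : μ.real {ω | history X Y n ω = h} =
      μ.real ({ω | history X Y n ω = h} ∩ {ω | Γ ω ≤ n}) +
        μ.real {ω | n < Γ ω ∧ history X Y n ω = h} := by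
    rw [← measureReal_inter_add_sdiff (s := {ω | history X Y n ω = h})
      (hp.measurable_changepoint measurableSet_Iic : MeasurableSet {ω | Γ ω ≤ n})]
    congr 2
    ext ω
    simp [and_comm]
  have hlt : μ.real {ω | n < Γ ω ∧ history X Y n ω = h} =
      (1 - ρ) ^ n * (historyMass W sense n n h).toReal := by
    rw [Measure.real, hp.measure_lt_changepoint_history ⟨hρ0, hρ1⟩, ENNReal.toReal_mul,
      ENNReal.toReal_ofReal (by have := sub_pos.2 hρ1; positivity)]
  have hr1 : 0 < 1 - ρ := sub_pos.2 hρ1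
  have hrd : (1 - ρ) * Real.exp (-Real.log (1 - ρ)) = 1 := by
    rw [Real.exp_neg, Real.exp_log hr1, mul_inv_cancel₀ hr1.ne']
  have heq : μ.real {ω | Γ ω = k ∧ history X Y n ω = h} =
      ρ / (1 - ρ) * ((1 - ρ) ^ n * (historyMass W sense n n h).toReal) *
        Real.exp (driftedWalk W (-Real.log (1 - ρ)) k n h) := by
    rw [Measure.real, hJ, ENNReal.toReal_mul, historyMass_toReal_eq W sense hac hrd hm, geomPrior,
      if_neg (by lia), ENNReal.toReal_ofReal (by positivity)]
    obtain ⟨j, rfl⟩ := Nat.exists_eq_add_of_le hkn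
    obtain ⟨l, rfl⟩ := Nat.exists_eq_add_of_le hk
    simp only [Nat.add_sub_cancel_left, pow_add]
    field_simp
  set a := μ.real {ω | Γ ω = k ∧ history X Y n ω = h}
  set p := μ.real ({ω | history X Y n ω = h} ∩ {ω | Γ ω ≤ n})
  set c := μ.real {ω | n < Γ ω ∧ history X Y n ω = h}
  have ha0 : 0 < a := ENNReal.toReal_pos hne (measure_ne_top _ _)
  have hc0 : 0 ≤ c := measureReal_nonneg
  change (μ.real {ω | history X Y n ω = h})⁻¹ * p < 1 - α at hpost
  rw [hsplit, inv_mul_lt_iff₀ (by linarith)] at hpost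
  rw [← hlt] at heq
  have hac' : α * a < (1 - α) * c := by nlinarith
  have hc : 0 < c := hc0.lt_of_ne' fun hc => by
    rw [hc, mul_zero] at hac'
    exact absurd hac' (not_lt.2 (by positivity))
  rw [← Real.log_mul (by have := sub_pos.2 hα1; positivity) (by positivity),
    Real.lt_log_iff_exp_lt (by have := sub_pos.2 hα1; positivity), div_mul_div_comm,
    lt_div_iff₀ (by positivity)]
  set E := Real.exp (driftedWalk W (-Real.log (1 - ρ)) k n h)
  have h5 : a * (1 - ρ) = ρ * c * E := by
    rw [heq]
    field_simp
  refine lt_of_mul_lt_mul_left (a := c) ?_ hc.le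
  have := mul_lt_mul_of_pos_right hac' hr1
  nlinarith

/-- Replaces a coupling with an i.i.d. walk: each running history is charged the passage mean for
the height it still has to climb. The start `t` varies so that one step of the process matches one
step of the recursion. -/
lemma IsSensingProcess.sum_measure_isRunning_le [Countable 𝒴] (hρ : ρ ∈ Set.Ioo (0 : ℝ) 1)
    (hp : IsSensingProcess W ρ sense μ Γ X Y Z) (hα : α ∈ Set.Ioo (0 : ℝ) 1)
    (hac : ∀ x y, aliceChannel W x false y = 0 → aliceChannel W x true y = 0)
    (β : unitInterval) (hconst : ConstantWhileRunning α β sense μ Γ X Y)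
    (N : ℕ) {k t : ℕ} (hkt : k ≤ t) :
    ∑ i ∈ Finset.range N,
        μ {ω | Γ ω = k ∧ IsRunning α μ Γ X Y (t + i) (history X Y (t + i) ω)} ≤
      ∑' h : Fin t → Bool × 𝒴, {h | IsRunning α μ Γ X Y t h}.indicator
        (fun h => μ {ω | Γ ω = k ∧ history X Y t ω = h} *
          ENNReal.ofReal (passageMean (stepLaw W β) (driftedLLR W (-Real.log (1 - ρ))) N
            (Real.log ((1 - α) / α) + Real.log ((1 - ρ) / ρ) -
              driftedWalk W (-Real.log (1 - ρ)) k t h))) h := by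
  induction N generalizing t with
  | zero => simp
  | succ N ih =>
    set A := Real.log ((1 - α) / α) + Real.log ((1 - ρ) / ρ)
    set d := -Real.log (1 - ρ)
    have hξ : Measurable (driftedLLR W d) := measurable_of_countable _
    rw [Finset.sum_range_succ']
    have hshift : ∀ i, μ {ω | Γ ω = k ∧ IsRunning α μ Γ X Y (t + (i + 1))
        (history X Y (t + (i + 1)) ω)} = μ {ω | Γ ω = k ∧ IsRunning α μ Γ X Y (t + 1 + i)
        (history X Y (t + 1 + i) ω)} := fun i => by rw [show t + (i + 1) = t + 1 + i by lia]
    simp_rw [hshift]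
    have hcover : μ {ω | Γ ω = k ∧ IsRunning α μ Γ X Y (t + 0) (history X Y (t + 0) ω)} ≤
        ∑' h : Fin t → Bool × 𝒴, {h | IsRunning α μ Γ X Y t h}.indicator
          (fun h => μ {ω | Γ ω = k ∧ history X Y t ω = h}) h := by
      rw [← tsum_subtype]
      refine (measure_mono ?_).trans (measure_iUnion_le _)
      intro ω hω
      exact Set.mem_iUnion.2 ⟨⟨_, hω.2⟩, hω.1, rfl⟩
    refine (add_le_add (ih (hkt.trans t.le_succ)) hcover).trans ?_
    rw [tsum_fin_succ_eq_tsum_snoc, ← ENNReal.tsum_add]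
    refine ENNReal.tsum_le_tsum fun h => ?_
    by_cases hr : IsRunning α μ Γ X Y t h
    swap
    · have hr' : ∀ b, ¬ IsRunning α μ Γ X Y (t + 1)
          (Fin.snoc (α := fun _ => Bool × 𝒴) h b) := fun b hb => hr hb.of_snoc
      simp [Set.indicator, hr, hr']
    simp only [Set.indicator, Set.mem_ofPred_eq, hr, if_true]
    have hs : sense t h = β := Subtype.ext (hconst t h hr)
    have hsnoc : ∀ b, μ {ω | Γ ω = k ∧ history X Y (t + 1) ω =
        Fin.snoc (α := fun _ => Bool × 𝒴) h b} = μ {ω | Γ ω = k ∧ history X Y t ω = h} *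
          (ENNReal.ofReal (berMass β b.1) * aliceChannel W b.1 true b.2) := fun b => by
      rw [hp.measure_changepoint_history, hp.measure_changepoint_history, historyMass_snoc, hs,
        mul_assoc, decide_eq_true (Nat.lt_succ_of_le hkt)]
    -- Null histories are set aside: the walk is known to be below the level, as the recursion
    -- requires, only on histories of positive mass.
    by_cases hJ : μ {ω | Γ ω = k ∧ history X Y t ω = h} = 0
    · simp [hsnoc, hJ]
    have hpos : 0 < A - driftedWalk W d k t h :=
      sub_pos.2 (hp.driftedWalk_lt hρ hα hac hkt hr hJ)
    rw [ofReal_passageMean_succ hξ N hpos, lintegral_stepLaw, mul_add, mul_one, add_comm,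
      ← ENNReal.tsum_mul_left]
    gcongr with b
    split_ifs
    · rw [hsnoc, driftedWalk_snoc W d hkt, sub_add_eq_sub_sub, mul_assoc, mul_assoc]
    · exact zero_le

end CovertQCD

/-! ### Moments of a step, and the delay as a tail sum. -/

namespace CovertQCD

section StepMoments

variable {𝒴 𝒵 : Type*} [Countable 𝒴] [MeasurableSpace 𝒴] [MeasurableSingletonClass 𝒴]
  {W : Bool → Bool → PMF (𝒴 × 𝒵)} {β : unitInterval} {f : Bool × 𝒴 → ℝ}

lemma integrable_stepLaw_and_integral_eq {cf ct : ℝ}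
    (h0 : HasSum (fun y => (aliceChannel W false true y).toReal * f (false, y)) cf)
    (h1 : HasSum (fun y => (aliceChannel W true true y).toReal * f (true, y)) ct) :
    Integrable f (stepLaw W β) ∧ ∫ b, f b ∂(stepLaw W β) = (1 - β) * cf + β * ct := by
  have hne : ∀ b : Bool × 𝒴,
      ENNReal.ofReal (berMass β b.1) * aliceChannel W b.1 true b.2 ≠ ∞ :=
    fun b => ENNReal.mul_ne_top ENNReal.ofReal_ne_top (PMF.apply_ne_top _ _)
  have hβ0 := β.2.1
  have hβ1 := sub_nonneg.2 β.2.2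
  have hfalse : (ENNReal.ofReal (berMass β false)).toReal = 1 - β := by
    simpa [berMass] using hβ1
  have htrue : (ENNReal.ofReal (berMass β true)).toReal = β := by
    simpa [berMass] using hβ0
  have hsum : HasSum (fun b : Bool × 𝒴 =>
      (ENNReal.ofReal (berMass β b.1) * aliceChannel W b.1 true b.2).toReal * f b)
      ((1 - β) * cf + β * ct) := by
    rw [← (Equiv.boolProdEquivSum 𝒴).symm.hasSum_iff]
    refine HasSum.sum ?_ ?_
    · simpa [Function.comp_def, Equiv.boolProdEquivSum, hfalse, mul_assoc] using
        h0.mul_left (1 - (β : ℝ))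
    · simpa [Function.comp_def, Equiv.boolProdEquivSum, htrue, mul_assoc] using
        h1.mul_left (β : ℝ)
  have hint : Integrable f (stepLaw W β) := by
    refine integrable_sum_dirac hne ?_
    simpa [abs_mul] using hsum.summable.norm
  refine ⟨hint, ?_⟩
  have := hasSum_integral_measure hint
  simp only [integral_smul_measure, integral_dirac, smul_eq_mul] at this
  exact this.unique hsum

end StepMoments

lemma tsum_indicator_lt_eq_toENNReal (m : ℕ∞) :
    ∑' n : ℕ, {n : ℕ | (n : ℕ∞) < m}.indicator (fun _ => (1 : ℝ≥0∞)) n = m := by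
  rw [← tsum_subtype, ENNReal.tsum_set_one]
  congr 1
  induction m using ENat.recTopCoe with
  | top => simp
  | coe m =>
    have : {n : ℕ | (n : ℕ∞) < m} = ↑(Finset.range m) := by ext; simp
    rw [this, Set.encard_coe_eq_coe_finsetCard, Finset.card_range]

variable {𝒴 𝒵 Ω : Type*} [MeasurableSpace Ω] [MeasurableSpace 𝒴] [MeasurableSpace 𝒵]
  {μ : Measure Ω} {Γ : Ω → ℕ} {X : ℕ → Ω → Bool} {Y : ℕ → Ω → 𝒴} {Z : ℕ → Ω → 𝒵}
  {W : Bool → Bool → PMF (𝒴 × 𝒵)} {ρ α : ℝ} {sense : SensingRule 𝒴}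

omit [MeasurableSpace 𝒴] in
lemma isRunning_of_lt_shiryaevTime {n : ℕ} {ω : Ω} (h : (n : ℕ∞) < shiryaevTime α μ Γ X Y ω) :
    IsRunning α μ Γ X Y n (history X Y n ω) := by
  intro t ht h1
  by_contra hc
  refine absurd (h.trans_le (iInf₂_le t ⟨h1, not_lt.1 hc⟩)) ?_
  simpa using ht

variable [Countable 𝒴] [MeasurableSingletonClass 𝒴]

/-- Write the delay as the sum over n of the indicators of Γ + n < τ, and split over the value of
`Γ`. -/
lemma IsSensingProcess.averageDetectionDelay_le_tsum
    (hp : IsSensingProcess W ρ sense μ Γ X Y Z) :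
    averageDetectionDelay μ Γ (shiryaevTime α μ Γ X Y) ≤
      ∑' k, ∑' n, μ {ω | Γ ω = k ∧ IsRunning α μ Γ X Y (k + n) (history X Y (k + n) ω)} := by
  have hmeas : ∀ k n, MeasurableSet
      {ω | Γ ω = k ∧ IsRunning α μ Γ X Y (k + n) (history X Y (k + n) ω)} := fun k n =>
    (hp.measurable_changepoint (measurableSet_singleton k)).inter
      (hp.measurable_history (k + n)
        (Set.to_countable {h | IsRunning α μ Γ X Y (k + n) h}).measurableSet)
  calc averageDetectionDelay μ Γ (shiryaevTime α μ Γ X Y)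
    _ ≤ ∫⁻ ω, ∑' k, ∑' n, {ω | Γ ω = k ∧ IsRunning α μ Γ X Y (k + n)
          (history X Y (k + n) ω)}.indicator (fun _ => (1 : ℝ≥0∞)) ω ∂μ := by
      refine lintegral_mono fun ω => ?_
      rw [← tsum_indicator_lt_eq_toENNReal]
      refine le_trans ?_ (ENNReal.le_tsum (Γ ω))
      refine ENNReal.tsum_le_tsum fun n => ?_
      by_cases hn : n ∈ {n : ℕ | (n : ℕ∞) < shiryaevTime α μ Γ X Y ω - Γ ω}
      swap
      · rw [Set.indicator_of_notMem hn]
        exact zero_le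
      have hlt : ((Γ ω + n : ℕ) : ℕ∞) < shiryaevTime α μ Γ X Y ω := by
        rw [Nat.cast_add]
        exact lt_tsub_iff_left.1 hn
      rw [Set.indicator_of_mem hn,
        Set.indicator_of_mem (by exact ⟨rfl, isRunning_of_lt_shiryaevTime hlt⟩)]
    _ = _ := by
      rw [lintegral_tsum fun k => (Measurable.tsum fun n =>
        measurable_const.indicator (hmeas k n)).aemeasurable]
      refine tsum_congr fun k => ?_
      rw [lintegral_tsum fun n => (measurable_const.indicator (hmeas k n)).aemeasurable]
      refine tsum_congr fun n => ?_
      rw [lintegral_indicator (hmeas k n)]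
      simp

variable [Countable 𝒵] [MeasurableSingletonClass 𝒵] [IsProbabilityMeasure μ]

/-- Start the comparison at t = k, where the walk is 0 and the full level remains; the bound is then
the same for every k. -/
lemma IsSensingProcess.averageDetectionDelay_le (hρ : ρ ∈ Set.Ioo (0 : ℝ) 1)
    (hp : IsSensingProcess W ρ sense μ Γ X Y Z) (hα : α ∈ Set.Ioo (0 : ℝ) 1)
    (hac : ∀ x y, aliceChannel W x false y = 0 → aliceChannel W x true y = 0)
    (β : unitInterval) (hconst : ConstantWhileRunning α β sense μ Γ X Y) {c : ℝ}
    (hc : ∀ N, passageMean (stepLaw W β) (driftedLLR W (-Real.log (1 - ρ))) N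
      (Real.log ((1 - α) / α) + Real.log ((1 - ρ) / ρ)) ≤ c) :
    averageDetectionDelay μ Γ (shiryaevTime α μ Γ X Y) ≤ ENNReal.ofReal c := by
  refine hp.averageDetectionDelay_le_tsum.trans ?_
  have hk : ∀ k, ∑' n, μ {ω | Γ ω = k ∧ IsRunning α μ Γ X Y (k + n)
      (history X Y (k + n) ω)} ≤ μ (Γ ⁻¹' {k}) * ENNReal.ofReal c := by
    intro k
    rw [ENNReal.tsum_eq_iSup_nat]
    refine iSup_le fun N => (hp.sum_measure_isRunning_le hρ hα hac β hconst N le_rfl).trans ?_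
    have hdisj : ∑' h : Fin k → Bool × 𝒴, μ {ω | Γ ω = k ∧ history X Y k ω = h} ≤
        μ (Γ ⁻¹' {k}) := by
      refine (tsum_meas_le_meas_iUnion_of_disjoint μ (fun h => ?_) fun h h' hne => ?_).trans
        (measure_mono (Set.iUnion_subset fun h ω hω => hω.1))
      · exact (hp.measurable_changepoint (measurableSet_singleton k)).inter
          (hp.measurable_history k (measurableSet_singleton h))
      · exact Set.disjoint_left.2 fun ω h1 h2 => hne (h1.2.symm.trans h2.2)
    refine le_trans ?_ (mul_le_mul_left hdisj (ENNReal.ofReal c))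
    rw [← ENNReal.tsum_mul_right]
    refine ENNReal.tsum_le_tsum fun h => (Set.indicator_le_self _ _ h).trans ?_
    rw [driftedWalk_self, sub_zero]
    gcongr
    exact hc N
  refine (ENNReal.tsum_le_tsum hk).trans ?_
  rw [ENNReal.tsum_mul_right]
  refine (mul_le_mul_left ?_ _).trans (one_mul _).le
  refine (tsum_meas_le_meas_iUnion_of_disjoint μ
    (fun k => hp.measurable_changepoint (measurableSet_singleton k)) fun k k' hne => ?_).trans
      prob_le_one
  exact Set.disjoint_left.2 fun ω h1 h2 => hne (h1.symm.trans h2)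

end CovertQCD

/-! ### Assembly of the bound. -/

theorem mainTheorem3
    {𝒴 𝒵 : Type*} [Countable 𝒴] [Countable 𝒵]
    [MeasurableSpace 𝒴] [MeasurableSingletonClass 𝒴]
    [MeasurableSpace 𝒵] [MeasurableSingletonClass 𝒵]
    (W : Bool → Bool → PMF (𝒴 × 𝒵))
    -- no free passive sensing
    (hpassive : CovertQCD.aliceChannel W false true = CovertQCD.aliceChannel W false false)
    (D V : ℝ)
    (hD : D = CovertQCD.relEntropy
      (CovertQCD.aliceChannel W true true) (CovertQCD.aliceChannel W true false))
    (hV : V = CovertQCD.relSecondMoment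
      (CovertQCD.aliceChannel W true true) (CovertQCD.aliceChannel W true false))
    -- `0 < D < ∞` and `V < ∞`
    (hDpos : 0 < D)
    (hDfin : CovertQCD.FiniteRelEntropy
      (CovertQCD.aliceChannel W true true) (CovertQCD.aliceChannel W true false))
    (hVfin : CovertQCD.FiniteRelSecondMoment
      (CovertQCD.aliceChannel W true true) (CovertQCD.aliceChannel W true false))
    (ρ : ℝ) (hρ : ρ ∈ Set.Ioo (0 : ℝ) 1)
    (d : ℝ) (hd : d = |Real.log (1 - ρ)|)
    (α : ℝ) (hα : α ∈ Set.Ioo (0 : ℝ) (1 / 2))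
    (β : ℝ) (hβ : β ∈ Set.Ioc (0 : ℝ) 1)
    {Ω : Type*} [MeasurableSpace Ω] (μ : MeasureTheory.Measure Ω)
    [MeasureTheory.IsProbabilityMeasure μ]
    (Γ : Ω → ℕ) (X : ℕ → Ω → Bool) (Y : ℕ → Ω → 𝒴) (Z : ℕ → Ω → 𝒵)
    (sense : CovertQCD.SensingRule 𝒴)
    (hprocess : CovertQCD.IsSensingProcess W ρ sense μ Γ X Y Z)
    (hconst : CovertQCD.ConstantWhileRunning α β sense μ Γ X Y) :
    CovertQCD.averageDetectionDelay μ Γ (CovertQCD.shiryaevTime α μ Γ X Y) ≤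
      ENNReal.ofReal
        ((|Real.log α| - |Real.log (1 - α)| + Real.log ((1 - ρ) / ρ)) / (β * D + d) +
          (β * V + 2 * d * β * D + d ^ 2) / (β * D + d) ^ 2) := by
  obtain ⟨hα0, hα1⟩ := hα
  have hρ0 := hρ.1
  have hρ1 : 0 < 1 - ρ := sub_pos.2 hρ.2
  have hα1' : 0 < 1 - α := by linarith
  have hd' : d = -Real.log (1 - ρ) := by
    rw [hd, abs_of_nonpos (Real.log_nonpos hρ1.le (by linarith))]
  have hdpos : 0 < d := by
    rw [hd']
    exact neg_pos.2 (Real.log_neg hρ1 (by linarith))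
  have hA : |Real.log α| - |Real.log (1 - α)| = Real.log ((1 - α) / α) := by
    rw [abs_of_nonpos (Real.log_nonpos hα0.le (by linarith)),
      abs_of_nonpos (Real.log_nonpos hα1'.le (by linarith)),
      Real.log_div hα1'.ne' hα0.ne']
    ring
  have hac : ∀ x y, CovertQCD.aliceChannel W x false y = 0 →
      CovertQCD.aliceChannel W x true y = 0 := by
    rintro (_ | _) y h
    · rwa [hpassive]
    · exact hDfin.1 y h
  have hmass : ∀ P : PMF 𝒴, HasSum (fun y => (P y).toReal) 1 := fun P => by
    rw [← ENNReal.toReal_one, ← P.tsum_coe, ENNReal.tsum_toReal_eq (PMF.apply_ne_top P)]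
    exact (ENNReal.summable_toReal P.tsum_coe_ne_top).hasSum
  -- The ratio is 1, or 0/0 = 0 with `Real.log 0 = 0`; either way the logarithm vanishes.
  have hfalse : ∀ y, CovertQCD.driftedLLR W d (false, y) = d := fun y => by
    simp only [CovertQCD.driftedLLR, hpassive]
    by_cases h : (CovertQCD.aliceChannel W false false y).toReal = 0
    · simp [h]
    · simp [div_self h]
  have hDsum := hDfin.2.hasSum
  have hVsum : HasSum _ _ := Summable.hasSum hVfin
  rw [← CovertQCD.relEntropy, ← hD] at hDsum
  rw [← CovertQCD.relSecondMoment, ← hV] at hVsum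
  set βI : unitInterval := ⟨β, hβ.1.le, hβ.2⟩
  obtain ⟨hint, hmean⟩ := CovertQCD.integrable_stepLaw_and_integral_eq (W := W) (β := βI)
    (f := CovertQCD.driftedLLR W d) (cf := d) (ct := D + d)
    (by simpa [hfalse] using (hmass (CovertQCD.aliceChannel W false true)).mul_right d)
    (by
      convert! hDsum.add ((hmass (CovertQCD.aliceChannel W true true)).mul_right d) using 1
      · funext y
        simp only [CovertQCD.driftedLLR]
        ring
      · ring)
  obtain ⟨hsq, hsecond⟩ := CovertQCD.integrable_stepLaw_and_integral_eq (W := W) (β := βI)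
    (f := fun b => CovertQCD.driftedLLR W d b ^ 2) (cf := d ^ 2) (ct := V + 2 * d * D + d ^ 2)
    (by simpa [hfalse] using (hmass (CovertQCD.aliceChannel W false true)).mul_right (d ^ 2))
    (by
      convert! (hVsum.add (hDsum.mul_left (2 * d))).add
        ((hmass (CovertQCD.aliceChannel W true true)).mul_right (d ^ 2)) using 1
      · funext y
        simp only [CovertQCD.driftedLLR]
        ring
      · ring)
  have hmean' : ∫ b, CovertQCD.driftedLLR W d b ∂(CovertQCD.stepLaw W βI) = β * D + d := by
    rw [hmean]
    change (1 - β) * d + β * (D + d) = _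
    ring
  have hsecond' : ∫ b, CovertQCD.driftedLLR W d b ^ 2 ∂(CovertQCD.stepLaw W βI) =
      β * V + 2 * d * β * D + d ^ 2 := by
    rw [hsecond]
    change (1 - β) * d ^ 2 + β * (V + 2 * d * D + d ^ 2) = _
    ring
  have hmpos : 0 < β * D + d := by
    have := mul_pos hβ.1 hDpos
    linarith
  rw [hA]
  set A := Real.log ((1 - α) / α) + Real.log ((1 - ρ) / ρ) with hAdef
  -- Lorden's bound needs a nonnegative level. For A ≤ 0 the passage mean is 0, so the delay is 0,
  -- which is below any `ENNReal.ofReal`.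
  rcases le_or_gt A 0 with hA0 | hA0
  · refine (hprocess.averageDetectionDelay_le hρ ⟨hα0, by linarith⟩ hac βI hconst (c := 0)
      fun N => (CovertQCD.passageMean_of_nonpos N hA0).le).trans ?_
    simp
  · refine hprocess.averageDetectionDelay_le hρ ⟨hα0, by linarith⟩ hac βI hconst fun N => ?_
    have h := CovertQCD.passageMean_le_of_pos (measurable_of_countable _) hint hsq
      (hmean' ▸ hmpos) N hA0.le
    rw [hmean', hsecond'] at h
    rwa [← hd']
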